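/- **Model.** A network configuration is a triple $(G,\mathrm{id},x)$, where $G=(V,E)$ is a finite connected simple graph on $n$ nodes, $\mathrm{id}:V\to\{1,\dots,n^c\}$ is injective ($c\ge 1$ a fixed integer) and $x:V\to\{0,1\}^*$ assigns an input label to every node. A distributed language is a set of network configurations. $\mathsf{Sym}$ is the set of configurations whose graph $G$ has an automorphism different from the identity, and $\overline{\mathsf{Sym}}$ is its complement in the set of all configurations. A (two-interaction) distributed Arthur–Merlin protocol runs as follows on $\mathcal I=(G,\mathrm{id},x)$. Arthur tosses $\rho(n)$ uniform random bits, either one string $r$ known to all nodes (shared randomness) or one independent string $r(v)$ at each node $v$ (distributed randomness). Merlin, who knows $\mathcal I$ and the outcome of all coin tosses, gives every node $v$ a certificate. Then every node $v$ sends to each neighbour $u$ a message that is a function of $n$, $\mathrm{id}(v)$, $\mathrm{id}(u)$, $x(v)$, the random string at $v$ and the certificate of $v$. Finally $v$ accepts or rejects deterministically, as a function of $n$, $\mathrm{id}(v)$, $x(v)$, its random string, its certificate, and the messages received from its neighbours (together with the identities of their senders). For $\sigma,\gamma:\mathbb N\to\mathbb N\cup\{\infty\}$, the class $\mathsf{dAM}(\sigma,\gamma)$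 consists of the distributed languages $\mathcal L$ that have such a protocol with certificates of at most $\sigma(n)$ bits and messages of at most $\gamma(n)$ bits such that, for every configuration $\mathcal I$: if $\mathcal I\in\mathcal L$, then some strategy of Merlin makes all nodes accept with probability at least $2/3$; if $\mathcal I\notin\mathcal L$, then for every strategy of Merlin at least one node rejects with probability at least $2/3$. **Theorem.** Any Arthur–Merlin protocol for $\mathsf{Sym}$ or for $\overline{\mathsf{Sym}}$ must have certificate size $\Omega(\log\log n)$ and message size $\Omega(\log\log n)$, even with shared randomness. Precisely, there are absolute constants $C>0$ and $N$ such that, for every integer $c\ge1$, for shared as well as for distributed randomness, and for all $\sigma,\gamma:\mathbb N\to\mathbb N\cup\{\infty\}$: if $\mathsf{Sym}\in\mathsf{dAM}(\sigma,\gamma)$ or $\overline{\mathsf{Sym}}\in\mathsf{dAM}(\sigma,\gamma)$, then $$\sigma(n)\ge C\log\log n\quad\text{and}\quad\gamma(n)\ge C\log\log n\qquad\text{for all } n\ge N .$$ In particular, for every $c\ge 1$, both kinds of randomness, and every $\tau:\mathbb N\to\mathbb N$ with $\tau(n)=o(\log\log n)$, $$\mathsf{Sym},\ \overline{\mathsf{Sym}}\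 \notin\ \mathsf{dAM}(\tau,\infty)\cup\mathsf{dAM}(\infty,\tau).$$ -/

import Mathlib

open Filter Asymptotics

/-- A network configuration `(G, id, x)`: a finite connected simple graph `G` on `n` nodes, a
one-to-one assignment of identities in `{1, …, n ^ c}`, and an input label (a bit string) at every
node. -/
structure NetworkConfig (c : ℕ) where
  V : Type
  finite : Finite V
  graph : SimpleGraph V
  connected : graph.Connected
  ident : V → ℕ
  ident_injective : Function.Injective ident
  ident_mem : ∀ v, ident v ∈ Set.Icc 1 (Nat.card V ^ c)
  label : V → List Bool

/-- The number `n` of nodes of the network. -/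
noncomputable def NetworkConfig.size {c : ℕ} (I : NetworkConfig c) : ℕ := Nat.card I.V

/-- A distributed language is a collection of network configurations. -/
abbrev DistributedLanguage (c : ℕ) := Set (NetworkConfig c)

/-- The language of symmetric graphs: the configurations whose graph has an automorphism
different from the identity (identities and labels play no role). -/
def SymLang (c : ℕ) : DistributedLanguage c :=
  {I | ∃ φ : I.graph ≃g I.graph, ∃ v, φ v ≠ v}

/-- Arthur's coins are either shared by all nodes or private to each node. -/
inductive Randomness where
  | shared
  | distributed

/-- The outcomes of Arthur's coin tosses with `ρ` random bits: one common string of `ρ` bits, or one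
string of `ρ` bits for each node. -/
def Coins : Randomness → Type → ℕ → Type
  | .shared, _, ρ => Fin ρ → Bool
  | .distributed, V, ρ => V → Fin ρ → Bool

/-- The random string seen by node `v`. -/
def coinsAt {V : Type} {ρ : ℕ} : (R : Randomness) → Coins R V ρ → V → (Fin ρ → Bool)
  | .shared, r, _ => r
  | .distributed, r, v => r v

/-- The probability of the event `E` under the uniform distribution on a finite type. -/
noncomputable def uniformProb {Ω : Type} (E : Ω → Prop) : ℝ :=
  (Nat.card {ω // E ω} : ℝ) / (Nat.card Ω : ℝ)

/-- Arthur's part of an Arthur-Merlin protocol with two interactions (Arthur tosses coins, Merlin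
answers with certificates) followed by a deterministic one-round verification algorithm.

* On networks with `n` nodes, `ρ n` random bits are tossed (by all nodes together if the randomness
  is shared, by each node if it is distributed).
* `message n i j x s w` is the message that the node with identity `i`, input label `x`, random
  string `s` and certificate `w` sends to its neighbour with identity `j`.
* `accept n i x s w m` is the verdict of that node once it has received the messages `m`, given as
  the set of all pairs (identity of a neighbour, message sent by this neighbour).

The verifier may depend arbitrarily on `n`, and need not be computable. -/
structure AMVerifier where
  ρ : ℕ → ℕ
  message : (n : ℕ) → (i j : ℕ) → (x : List Bool) → (s : Fin (ρ n) → Bool) → (w : List Bool) →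
    List Bool
  accept : (n : ℕ) → (i : ℕ) → (x : List Bool) → (s : Fin (ρ n) → Bool) → (w : List Bool) →
    (m : Set (ℕ × List Bool)) → Prop

namespace AMVerifier

variable {c : ℕ} (P : AMVerifier) (R : Randomness) (I : NetworkConfig c)

/-- The outcomes of Arthur's coin tosses when the protocol is run on `I`. -/
abbrev CoinsOn : Type := Coins R I.V (P.ρ I.size)

/-- The message `M_{u,v}` that `u` sends to `v`, for the coin outcome `r` and the certificates `w`. -/
noncomputable def sent (r : P.CoinsOn R I) (w : I.V → List Bool) (u v : I.V) : List Bool :=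
  P.message I.size (I.ident u) (I.ident v) (I.label u) (coinsAt R r u) (w u)

/-- The messages received by `v`, each with the identity of its sender. -/
def received (r : P.CoinsOn R I) (w : I.V → List Bool) (v : I.V) : Set (ℕ × List Bool) :=
  {m | ∃ u, I.graph.Adj v u ∧ m = (I.ident u, P.sent R I r w u v)}

/-- Node `v` accepts, for the coin outcome `r` and the certificates `w`. -/
def AcceptsAt (r : P.CoinsOn R I) (w : I.V → List Bool) (v : I.V) : Prop :=
  P.accept I.size (I.ident v) (I.label v) (coinsAt R r v) (w v) (P.received R I r w v)

/-- A strategy of Merlin on the configuration `I`: knowing `I` and the outcome of all coin tosses, he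
gives a certificate to every node. -/
abbrev Prover : Type := P.CoinsOn R I → I.V → List Bool

/-- Merlin's certificates have at most `s` bits. -/
def Prover.BoundedBy {P : AMVerifier} {R : Randomness} {I : NetworkConfig c}
    (p : P.Prover R I) (s : ℕ∞) : Prop :=
  ∀ r v, ((p r v).length : ℕ∞) ≤ s

/-- On networks with `n` nodes, the messages have at most `γ n` bits whenever the certificates have at
most `σ n` bits. -/
def MessagesBoundedBy (σ γ : ℕ → ℕ∞) : Prop :=
  ∀ (n i j : ℕ) (x : List Bool) (s : Fin (P.ρ n) → Bool) (w : List Bool),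
    (w.length : ℕ∞) ≤ σ n → ((P.message n i j x s w).length : ℕ∞) ≤ γ n

end AMVerifier

/-- The class `dAM(σ, γ)` of the distributed languages that have an Arthur-Merlin protocol (Arthur
tosses coins of the kind `R`, then Merlin answers) with certificates of at most `σ n` bits and
messages of at most `γ n` bits on networks with `n` nodes; the value `⊤` means that there is no
bound. -/
def dAM {c : ℕ} (R : Randomness) (σ γ : ℕ → ℕ∞) : Set (DistributedLanguage c) :=
  {L | ∃ P : AMVerifier, P.MessagesBoundedBy σ γ ∧ ∀ I : NetworkConfig c,
    (I ∈ L → ∃ p : P.Prover R I, p.BoundedBy (σ I.size) ∧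
      2 / 3 ≤ uniformProb fun r => ∀ v, P.AcceptsAt R I r (p r) v) ∧
    (I ∉ L → ∀ p : P.Prover R I, p.BoundedBy (σ I.size) →
      2 / 3 ≤ uniformProb fun r => ∃ v, ¬ P.AcceptsAt R I r (p r) v)}

/-!
The lower bound is proved on *broom graphs*: a path (the handle), to whose first vertex `2k`
bristles are attached. A bristle is a path with one additional leaf, and the position of that leaf is
a parameter `F i` that only the bristle itself can see: the node set and the identities are the same
for all values of the parameters, and labels are empty. The graph has a nontrivial automorphism if
and only if two bristles have the same parameter (`broomGraph_symmetric`, `broomGraph_rigid`).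

Fix the outcome of the coins, shared or not. A bristle communicates with the rest of the network
along one edge only. Its *type* is the set of pairs of messages on this edge that Merlin can complete
to certificates which make the bristle accept; whether Merlin can convince all nodes depends on the
types of the bristles only (`LocallyAccepted.replace_bristles`). If the certificates, or the messages,
have at most `s` bits, then at most `B = 2 ^ (s + 1)` messages are possible in each direction, and
there are at most `D = 2 ^ (B * B)` types.

Arrange the bristles in `k` pairs. Parameters drawn uniformly at random from a large set are pairwise
distinct with high probability, while a symmetric graph arises from them by planting: choose
a random pair and copy the parameter of its first member to the second. A test that sees the types
only does not notice the planting. The law of the types after planting in the pair `t` has a density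
`h t` with respect to the original law; it depends on the pair `t` only, has mean `1`, and second
moment at most `D ^ 2`. These densities are independent, so by the Cauchy-Schwarz inequality the
acceptance probabilities before and after the planting in a random pair differ by at most `D / √k`
(`sq_sum_planted_sub_le`). A protocol for symmetry or for its complement makes them differ by at least
`1 / 4`, so `k ≤ 16 * D ^ 2` (`card_pairs_le`). On `n` nodes there is room for `k` of order
`n ^ (1 / 4)`, so `log n` is at most a constant times `4 ^ s`, which is the claim.
-/

/-! ### Planting a coincidence in a random tuple -/

section Planting

/-- Resampling one coordinate of a uniformly random tuple does not change its distribution. -/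
theorem sum_sum_update {ι U : Type*} [Fintype ι] [DecidableEq ι] [Fintype U]
    (φ : (ι → U) → ℝ) (i : ι) :
    ∑ F : ι → U, ∑ u, φ (Function.update F i u) = Fintype.card U * ∑ F, φ F := by
  classical
  have hT : Function.Involutive
      (fun p : (ι → U) × U => (Function.update p.1 i p.2, p.1 i)) := by
    rintro ⟨F, u⟩
    simp
  have h := Equiv.sum_comp hT.toPerm (fun p : (ι → U) × U => φ p.1)
  rw [Fintype.sum_prod_type, Fintype.sum_prod_type] at h
  simpa [Finset.mul_sum] using h

theorem sum_sum_sum_update {ι U : Type*} [Fintype ι] [DecidableEq ι] [Fintype U]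
    (φ : (ι → U) → ℝ) (i j : ι) :
    ∑ F : ι → U, ∑ u, ∑ v, φ (Function.update (Function.update F i u) j v) =
      (Fintype.card U : ℝ) ^ 2 * ∑ F, φ F := by
  rw [sum_sum_update (fun G => ∑ v, φ (Function.update G j v)) i, sum_sum_update]
  ring

variable {U T : Type*} [Fintype U]

open Classical in
/-- The number of elements with the same type as `u`. -/
noncomputable def fiberCard (X : U → T) (u : U) : ℝ :=
  ∑ a, if X a = X u then 1 else 0

open Classical in
/-- The number of elements whose `X`-type is that of `u` and whose `Y`-type is that of `v`. -/
noncomputable def jointCard (X Y : U → T) (u v : U) : ℝ :=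
  ∑ a, if X a = X u ∧ Y a = Y v then 1 else 0

/-- For `a`, `u`, `v` uniform and independent, the law of the pair of types `(X a, Y a)` has a
density with respect to the law of `(X u, Y v)`; this is that density, as a function of `(u, v)`. -/
noncomputable def typeDensity (X Y : U → T) (u v : U) : ℝ :=
  Fintype.card U * jointCard X Y u v / (fiberCard X u * fiberCard Y v)

theorem fiberCard_pos (X : U → T) (u : U) : 0 < fiberCard X u := by
  unfold fiberCard
  refine Finset.sum_pos' (fun a _ => by split_ifs <;> norm_num) ⟨u, Finset.mem_univ _, by simp⟩

theorem fiberCard_congr {X : U → T} {u v : U} (h : X u = X v) :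
    fiberCard X u = fiberCard X v := by
  unfold fiberCard
  rw [h]

theorem jointCard_nonneg (X Y : U → T) (u v : U) : 0 ≤ jointCard X Y u v :=
  Finset.sum_nonneg fun a _ => by split_ifs <;> norm_num

theorem jointCard_le_left (X Y : U → T) (u v : U) : jointCard X Y u v ≤ fiberCard X u :=
  Finset.sum_le_sum fun a _ => by by_cases h : X a = X u <;> by_cases h' : Y a = Y v <;> simp [h, h']

theorem jointCard_le_right (X Y : U → T) (u v : U) : jointCard X Y u v ≤ fiberCard Y v :=
  Finset.sum_le_sum fun a _ => by by_cases h : X a = X u <;> by_cases h' : Y a = Y v <;> simp [h, h']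

/-- Integrating a function of the two types against the density is the same as evaluating it on
the diagonal. -/
theorem sum_mul_typeDensity (X Y : U → T) (φ : U → U → ℝ)
    (hφ : ∀ u u' v v', X u = X u' → Y v = Y v' → φ u v = φ u' v') :
    ∑ u, ∑ v, φ u v * typeDensity X Y u v = Fintype.card U * ∑ a, φ a a := by
  classical
  have key : ∀ u v, φ u v * typeDensity X Y u v = Fintype.card U * ∑ a,
      (φ a a / (fiberCard X a * fiberCard Y a)) *
        ((if X u = X a then 1 else 0) * (if Y v = Y a then 1 else 0)) := by
    intro u v
    rw [typeDensity, jointCard, Finset.mul_sum, Finset.mul_sum, Finset.sum_div, Finset.mul_sum]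
    refine Finset.sum_congr rfl fun a _ => ?_
    by_cases h : X a = X u
    · by_cases h' : Y a = Y v
      · rw [hφ a u a v h h', fiberCard_congr h, fiberCard_congr h']
        simp [h, h']
        ring
      · simp [h', Ne.symm h']
    · simp [h, Ne.symm h]
  simp_rw [key, ← Finset.mul_sum]
  congr 1
  have : ∀ u, ∑ v, ∑ a, (φ a a / (fiberCard X a * fiberCard Y a)) *
        ((if X u = X a then (1:ℝ) else 0) * (if Y v = Y a then 1 else 0)) =
      ∑ a, (φ a a / (fiberCard X a * fiberCard Y a)) *
        ((if X u = X a then (1:ℝ) else 0) * fiberCard Y a) := by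
    intro u
    rw [Finset.sum_comm]
    refine Finset.sum_congr rfl fun a _ => ?_
    rw [← Finset.mul_sum, ← Finset.mul_sum]
    rfl
  simp_rw [this]
  rw [Finset.sum_comm]
  refine Finset.sum_congr rfl fun a _ => ?_
  rw [← Finset.mul_sum, ← Finset.sum_mul]
  change _ * (fiberCard X a * fiberCard Y a) = _
  have := fiberCard_pos X a
  have := fiberCard_pos Y a
  field_simp

open Classical in
theorem sum_inv_fiberCard (X : U → T) :
    ∑ u, (fiberCard X u)⁻¹ = (Finset.univ.image X).card := by
  rw [← Finset.sum_fiberwise_of_maps_to (t := Finset.univ.image X) (g := X)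
    (fun u _ => Finset.mem_image_of_mem _ (Finset.mem_univ u)), Finset.card_eq_sum_ones]
  push_cast
  refine Finset.sum_congr rfl fun z hz => ?_
  obtain ⟨u, -, rfl⟩ := Finset.mem_image.1 hz
  rw [Finset.sum_congr rfl (g := fun _ => (fiberCard X u)⁻¹)
    (fun a ha => by rw [fiberCard_congr (Finset.mem_filter.1 ha).2])]
  rw [Finset.sum_const, nsmul_eq_mul]
  have h : ((Finset.univ.filter (fun a => X a = X u)).card : ℝ) = fiberCard X u := by
    simp [fiberCard]
  rw [h, mul_inv_cancel₀ (fiberCard_pos X u).ne']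

open Classical in
/-- The second moment of the density is at most the number of pairs of types. -/
theorem sum_typeDensity_sub_one_sq_le (X Y : U → T) {D : ℝ}
    (hX : ((Finset.univ.image X).card : ℝ) ≤ D) (hY : ((Finset.univ.image Y).card : ℝ) ≤ D) :
    ∑ u, ∑ v, (typeDensity X Y u v - 1) ^ 2 ≤ (Fintype.card U : ℝ) ^ 2 * D ^ 2 := by
  have h1 : ∑ u, ∑ v, typeDensity X Y u v = (Fintype.card U : ℝ) ^ 2 := by
    have := sum_mul_typeDensity X Y (fun _ _ => 1) (fun _ _ _ _ _ _ => rfl)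
    simpa [sq] using this
  have h2 : ∑ u, ∑ v, typeDensity X Y u v ^ 2 ≤ (Fintype.card U : ℝ) ^ 2 * D ^ 2 := by
    calc ∑ u, ∑ v, typeDensity X Y u v ^ 2
        ≤ ∑ u, ∑ v, (Fintype.card U : ℝ) ^ 2 * ((fiberCard X u)⁻¹ * (fiberCard Y v)⁻¹) := by
          refine Finset.sum_le_sum fun u _ => Finset.sum_le_sum fun v _ => ?_
          have hx := fiberCard_pos X u
          have hy := fiberCard_pos Y v
          -- the joint count is at most either fibre, so its square is at most their product
          have : jointCard X Y u v ^ 2 ≤ fiberCard X u * fiberCard Y v := by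
            rw [sq]
            exact mul_le_mul (jointCard_le_left ..) (jointCard_le_right ..)
              (jointCard_nonneg ..) hx.le
          have e : (Fintype.card U : ℝ) ^ 2 * ((fiberCard X u)⁻¹ * (fiberCard Y v)⁻¹) =
              (Fintype.card U : ℝ) ^ 2 * (fiberCard X u * fiberCard Y v) /
                (fiberCard X u * fiberCard Y v) ^ 2 := by
            field_simp
          rw [typeDensity, div_pow, mul_pow, e]
          gcongr
      _ = (Fintype.card U : ℝ) ^ 2 *
            ((Finset.univ.image X).card * (Finset.univ.image Y).card) := by
          rw [← sum_inv_fiberCard, ← sum_inv_fiberCard, Finset.sum_mul_sum]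
          simp_rw [Finset.mul_sum]
      _ ≤ (Fintype.card U : ℝ) ^ 2 * D ^ 2 := by
          rw [sq D]
          gcongr
          exact (Nat.cast_nonneg _).trans hX
  have h3 : ∑ u, ∑ v, (typeDensity X Y u v - 1) ^ 2 =
      ∑ u, ∑ v, typeDensity X Y u v ^ 2 - 2 * ∑ u, ∑ v, typeDensity X Y u v +
        (Fintype.card U : ℝ) ^ 2 := by
    simp_rw [sub_sq, Finset.sum_add_distrib, Finset.sum_sub_distrib, Finset.mul_sum]
    simp [sq]
  rw [h3, h1]
  nlinarith [sq_nonneg (Fintype.card U : ℝ)]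

open Classical in
/-- A random tuple `F : κ × Bool → U` and the tuple obtained from it by copying, for a random
`t : κ`, the coordinate `(t, false)` into `(t, true)` cannot be told apart by a test `f` that only
sees types, as soon as the number `D` of types is small compared to the square root of the
number of pairs. The densities of the planted laws are independent under the uniform law, so their
average has a small variance. -/
theorem sq_sum_planted_sub_le {κ : Type*} [Fintype κ] [DecidableEq κ] [Nonempty U] (X : κ × Bool → U → T) {D : ℝ}
    (hX : ∀ i, ((Finset.univ.image (X i)).card : ℝ) ≤ D) (f : (κ × Bool → U) → ℝ)
    (hf0 : ∀ F, 0 ≤ f F) (hf1 : ∀ F, f F ≤ 1)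
    (hf : ∀ F F', (∀ i, X i (F i) = X i (F' i)) → f F = f F') :
    (∑ t, (∑ F, f (Function.update F (t, true) (F (t, false))) - ∑ F, f F)) ^ 2 ≤
      Fintype.card κ * D ^ 2 * (Fintype.card (κ × Bool → U) : ℝ) ^ 2 := by
  set u : ℝ := (Fintype.card U : ℝ) with hu
  have hupos : 0 < u := by
    rw [hu]
    exact_mod_cast Fintype.card_pos
  set N : ℝ := (Fintype.card (κ × Bool → U) : ℝ) with hN
  set g : κ → U → U → ℝ := fun t a b => typeDensity (X (t, false)) (X (t, true)) a b - 1 with hg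
  set G : κ → (κ × Bool → U) → ℝ := fun t F => g t (F (t, false)) (F (t, true)) with hG
  have hsum0 : ∀ t, ∑ a, ∑ b, g t a b = 0 := by
    intro t
    have := sum_mul_typeDensity (X (t, false)) (X (t, true)) (fun _ _ => 1)
      (fun _ _ _ _ _ _ => rfl)
    simp only [one_mul] at this
    simp [hg, Finset.sum_sub_distrib, this]
  have hG2 : ∀ t F a b, G t (Function.update (Function.update F (t, false) a) (t, true) b) =
      g t a b := by
    intro t F a b
    simp [hG]
  have hcorr : ∀ t, ∑ F, f F * G t F =
      ∑ F, f (Function.update F (t, true) (F (t, false))) - ∑ F, f F := by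
    intro t
    have h1 := sum_sum_sum_update (fun F => f F * G t F) (t, false) (t, true)
    have h2 := sum_sum_sum_update f (t, false) (t, true)
    have h3 := sum_sum_update (fun F => f (Function.update F (t, true) (F (t, false)))) (t, false)
    simp only [Function.update_self] at h3
    simp only [hG2] at h1
    have h4 : ∀ F : κ × Bool → U,
        ∑ a, ∑ b, f (Function.update (Function.update F (t, false) a) (t, true) b) * g t a b =
        u * ∑ a, f (Function.update (Function.update F (t, false) a) (t, true) a) -
        ∑ a, ∑ b, f (Function.update (Function.update F (t, false) a) (t, true) b) := by
      intro F
      rw [hu, ← sum_mul_typeDensity (X (t, false)) (X (t, true)) (fun a b =>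
        f (Function.update (Function.update F (t, false) a) (t, true) b))]
      · simp [hg, mul_sub, Finset.sum_sub_distrib]
      · intro a a' b b' ha hb
        refine hf _ _ fun i => ?_
        by_cases hi : i = (t, true)
        · subst hi
          simpa using hb
        · by_cases hi' : i = (t, false)
          · subst hi'
            simpa using ha
          · simp [hi, hi']
    simp_rw [h4] at h1
    rw [Finset.sum_sub_distrib, ← Finset.mul_sum, h2, h3, ← hu] at h1
    have : u ^ 2 ≠ 0 := by positivity
    apply mul_left_cancel₀ this
    rw [← h1]
    ring
  have horth : ∀ s t, s ≠ t → ∑ F, G s F * G t F = 0 := by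
    intro s t hst
    have h1 := sum_sum_sum_update (fun F => G s F * G t F) (s, false) (s, true)
    have h2 : ∀ F a b, G t (Function.update (Function.update F (s, false) a) (s, true) b) =
        G t F := by
      intro F a b
      simp [hG, hst.symm]
    simp only [hG2, h2, ← Finset.sum_mul, hsum0, zero_mul, Finset.sum_const_zero] at h1
    have : u ^ 2 ≠ 0 := by positivity
    exact (mul_eq_zero.1 h1.symm).resolve_left this
  have hdiag : ∀ t, ∑ F, G t F * G t F ≤ N * D ^ 2 := by
    intro t
    have h1 := sum_sum_sum_update (fun F => G t F * G t F) (t, false) (t, true)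
    simp only [hG2] at h1
    have h2 := sum_typeDensity_sub_one_sq_le (X (t, false)) (X (t, true)) (hX _) (hX _)
    have h3 : ∑ a, ∑ b, g t a b * g t a b ≤ u ^ 2 * D ^ 2 := by
      simpa [hg, sq] using h2
    have : u ^ 2 * ∑ F, G t F * G t F ≤ u ^ 2 * (N * D ^ 2) := by
      rw [hu, ← h1]
      simp only [Finset.sum_const, Finset.card_univ, nsmul_eq_mul, ← hN]
      have hN0 : 0 ≤ N := Nat.cast_nonneg _
      nlinarith [mul_le_mul_of_nonneg_left h3 hN0]
    exact le_of_mul_le_mul_left this (by positivity)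
  have hvar : ∑ F, (∑ t, G t F) ^ 2 ≤ Fintype.card κ * (N * D ^ 2) := by
    calc ∑ F, (∑ t, G t F) ^ 2 = ∑ s, ∑ t, ∑ F, G s F * G t F := by
          simp_rw [sq, Finset.sum_mul_sum]
          rw [Finset.sum_comm]
          refine Finset.sum_congr rfl fun s _ => Finset.sum_comm
      _ = ∑ s, ∑ F, G s F * G s F := by
          refine Finset.sum_congr rfl fun s _ => ?_
          exact Finset.sum_eq_single s (fun t _ h => horth s t h.symm) (by simp)
      _ ≤ ∑ _s : κ, N * D ^ 2 := Finset.sum_le_sum fun s _ => hdiag s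
      _ = _ := by simp
  have hf2 : ∑ F, f F ^ 2 ≤ N := by
    calc ∑ F, f F ^ 2 ≤ ∑ _F : κ × Bool → U, (1 : ℝ) :=
          Finset.sum_le_sum fun F _ => pow_le_one₀ (hf0 F) (hf1 F)
      _ = N := by simp [hN]
  calc _ = (∑ F, f F * ∑ t, G t F) ^ 2 := by
        simp_rw [← hcorr, Finset.mul_sum]
        rw [Finset.sum_comm]
    _ ≤ (∑ F, f F ^ 2) * ∑ F, (∑ t, G t F) ^ 2 := Finset.sum_mul_sq_le_sq_mul_sq _ _ _
    _ ≤ N * (Fintype.card κ * (N * D ^ 2)) :=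
        mul_le_mul hf2 hvar (Finset.sum_nonneg fun _ _ => sq_nonneg _) (Nat.cast_nonneg _)
    _ = _ := by ring

open Classical in
/-- The birthday bound, multiplied out. -/
theorem card_not_injective_le {ι : Type*} [Fintype ι] [DecidableEq ι] :
    (Fintype.card U : ℝ) * ∑ F : ι → U, (if Function.Injective F then (0 : ℝ) else 1) ≤
      (Fintype.card ι : ℝ) ^ 2 * Fintype.card (ι → U) := by
  have h1 : ∀ F : ι → U, (if Function.Injective F then (0 : ℝ) else 1) ≤
      ∑ i, ∑ j, if i ≠ j ∧ F i = F j then 1 else 0 := by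
    intro F
    have h0 : ∀ i j, (0 : ℝ) ≤ if i ≠ j ∧ F i = F j then 1 else 0 := fun i j => by
      split_ifs <;> norm_num
    split_ifs with h
    · exact Finset.sum_nonneg fun i _ => Finset.sum_nonneg fun j _ => h0 i j
    · simp only [Function.Injective, not_forall] at h
      obtain ⟨i, j, hij, hne⟩ := h
      calc (1 : ℝ) = if i ≠ j ∧ F i = F j then 1 else 0 := by simp [hij, hne]
        _ ≤ ∑ j, if i ≠ j ∧ F i = F j then (1 : ℝ) else 0 :=
          Finset.single_le_sum (f := fun j => if i ≠ j ∧ F i = F j then (1 : ℝ) else 0)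
            (fun j _ => h0 i j) (Finset.mem_univ j)
        _ ≤ _ := Finset.single_le_sum
            (f := fun i => ∑ j, if i ≠ j ∧ F i = F j then (1 : ℝ) else 0)
            (fun i _ => Finset.sum_nonneg fun j _ => h0 i j) (Finset.mem_univ i)
  have h2 : ∀ i j, (Fintype.card U : ℝ) * ∑ F : ι → U, (if i ≠ j ∧ F i = F j then (1 : ℝ) else 0) ≤
      Fintype.card (ι → U) := by
    intro i j
    rw [← sum_sum_update _ i]
    by_cases hij : i = j
    · simp [hij]
    · simp [hij, Function.update_of_ne (Ne.symm hij)]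
  calc _ ≤ (Fintype.card U : ℝ) * ∑ F : ι → U, ∑ i, ∑ j, if i ≠ j ∧ F i = F j then (1 : ℝ) else 0 := by
        gcongr with F
        exact h1 F
    _ = ∑ i, ∑ j, (Fintype.card U : ℝ) *
          ∑ F : ι → U, if i ≠ j ∧ F i = F j then (1 : ℝ) else 0 := by
        rw [Finset.sum_comm, Finset.mul_sum]
        refine Finset.sum_congr rfl fun i _ => ?_
        rw [Finset.sum_comm, Finset.mul_sum]
    _ ≤ ∑ _i : ι, ∑ _j : ι, (Fintype.card (ι → U) : ℝ) :=
        Finset.sum_le_sum fun i _ => Finset.sum_le_sum fun j _ => h2 i j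
    _ = _ := by
        simp
        ring

end Planting

/-! ### The broom graphs -/

section Brooms

variable {ι : Type} {p m : ℕ}

/-- The vertices of a broom graph: a handle, which is a path on `p` vertices, and for each `i : ι`
a bristle with `m` vertices. -/
abbrev BroomVertex (ι : Type) (p m : ℕ) : Type := Fin p ⊕ ι × Fin m

/-- `j'` is a child of `j` in the bristle of parameter `f`: the vertices `0, …, m - 2` form a path
that starts at its root `0`, and the last vertex `m - 1` is a leaf attached to the vertex `f`. -/
def BristleChild (f : ℕ) (j j' : Fin m) : Prop :=
  (j'.val + 1 < m ∧ j.val + 1 = j'.val) ∨ (j'.val + 1 = m ∧ j.val = f)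

/-- `v` is a child of `u` in the broom with parameters `F`, a tree rooted at the first vertex
of the handle; the roots of the bristles are children of that vertex. -/
def BroomChild (F : ι → ℕ) : BroomVertex ι p m → BroomVertex ι p m → Prop
  | .inl a, .inl b => a.val + 1 = b.val
  | .inl a, .inr (_, j) => a.val = 0 ∧ j.val = 0
  | .inr _, .inl _ => False
  | .inr (i, j), .inr (i', j') => i = i' ∧ BristleChild (F i) j j'

/-- The depth of a vertex in the rooted tree. -/
def broomDepth (F : ι → ℕ) : BroomVertex ι p m → ℕ
  | .inl a => a.val
  | .inr (i, j) => if j.val + 1 < m then j.val + 1 else F i + 2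

theorem broomDepth_of_child {F : ι → ℕ} (hF : ∀ i, F i + 4 ≤ m) {u v : BroomVertex ι p m}
    (h : BroomChild F u v) : broomDepth F v = broomDepth F u + 1 := by
  rcases u with a | ⟨i, j⟩ <;> rcases v with b | ⟨i', j'⟩
  · simp only [BroomChild] at h
    simp [broomDepth, h]
  · simp only [BroomChild] at h
    have : 1 < m := by have := hF i'; omega
    simp [broomDepth, h, this]
  · exact h.elim
  · obtain ⟨rfl, h⟩ := h
    have := hF i
    simp only [BristleChild] at h
    simp only [broomDepth]
    split_ifs <;> omega

theorem broom_parent_unique {F : ι → ℕ} (hF : ∀ i, F i + 4 ≤ m) {u u' v : BroomVertex ι p m}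
    (h : BroomChild F u v) (h' : BroomChild F u' v) : u = u' := by
  rcases u with a | ⟨i, j⟩ <;> rcases u' with a' | ⟨i', j'⟩ <;> rcases v with b | ⟨i'', j''⟩ <;>
    simp only [BroomChild, BristleChild] at h h'
  · congr 1; ext; omega
  · congr 1; ext; omega
  · have := hF i'
    omega
  · have := hF i
    omega
  · obtain ⟨rfl, h⟩ := h
    obtain ⟨rfl, h'⟩ := h'
    congr 2; ext; omega

/-- The broom graph with parameters `F`. -/
def broomGraph (ι : Type) (p m : ℕ) (F : ι → ℕ) (hF : ∀ i, F i + 4 ≤ m) :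
    SimpleGraph (BroomVertex ι p m) where
  Adj u v := BroomChild F u v ∨ BroomChild F v u
  symm := ⟨fun _ _ h => h.symm⟩
  loopless := ⟨fun v h => by
    have h : BroomChild F v v := h.elim id id
    have := broomDepth_of_child hF h
    omega⟩

variable {F : ι → ℕ} {hF : ∀ i, F i + 4 ≤ m}

theorem broom_exists_parent {F : ι → ℕ} (hF : ∀ i, F i + 4 ≤ m) (v : BroomVertex ι p m)
    (hv : broomDepth F v ≠ 0) (hp : 0 < p) : ∃ u, BroomChild F u v := by
  rcases v with b | ⟨i, j⟩
  · simp only [broomDepth] at hv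
    refine ⟨.inl ⟨b.val - 1, by omega⟩, ?_⟩
    simp only [BroomChild]
    omega
  · have := hF i
    have := j.isLt
    by_cases h0 : j.val = 0
    · exact ⟨.inl ⟨0, hp⟩, by simp [BroomChild, h0]⟩
    · by_cases h1 : j.val + 1 < m
      · refine ⟨.inr (i, ⟨j.val - 1, by omega⟩), rfl, ?_⟩
        left
        simp only
        omega
      · refine ⟨.inr (i, ⟨F i, by omega⟩), rfl, ?_⟩
        exact Or.inr ⟨by omega, rfl⟩

theorem eq_handle_zero_of_depth {F : ι → ℕ} (hp : 0 < p) {v : BroomVertex ι p m}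
    (hv : broomDepth F v = 0) : v = .inl ⟨0, hp⟩ := by
  rcases v with b | ⟨i, j⟩
  · simp only [broomDepth] at hv
    congr 1
    ext
    exact hv
  · simp only [broomDepth] at hv
    split_ifs at hv

theorem broomGraph_connected (hp : 0 < p) : (broomGraph ι p m F hF).Connected := by
  have h : ∀ d (v : BroomVertex ι p m), broomDepth F v = d →
      (broomGraph ι p m F hF).Reachable (.inl ⟨0, hp⟩) v := by
    intro d
    induction d with
    | zero =>
      intro v hv
      rw [eq_handle_zero_of_depth hp hv]
    | succ d ih =>
      intro v hv
      obtain ⟨u, hu⟩ := broom_exists_parent hF v (by omega) hp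
      have hd := broomDepth_of_child hF hu
      have hadj : (broomGraph ι p m F hF).Adj u v := Or.inl hu
      exact (ih u (by omega)).trans hadj.reachable
  have : Nonempty (BroomVertex ι p m) := ⟨.inl ⟨0, hp⟩⟩
  exact SimpleGraph.Connected.mk fun u v => ((h _ u rfl).symm).trans (h _ v rfl)

/-- Two equal bristles can be exchanged. -/
theorem broomGraph_symmetric [DecidableEq ι] {i i' : ι} (hne : i ≠ i') (hi : F i = F i') :
    ∃ φ : broomGraph ι p m F hF ≃g broomGraph ι p m F hF, ∃ v, φ v ≠ v := by
  have hswap : ∀ l, F (Equiv.swap i i' l) = F l := by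
    intro l
    by_cases h1 : l = i
    · simp [h1, hi]
    · by_cases h2 : l = i'
      · simp [h2, hi]
      · rw [Equiv.swap_apply_of_ne_of_ne h1 h2]
  set e : BroomVertex ι p m ≃ BroomVertex ι p m :=
    Equiv.sumCongr (Equiv.refl _) (Equiv.prodCongr (Equiv.swap i i') (Equiv.refl _)) with he
  have hchild : ∀ u v, BroomChild F (e u) (e v) ↔ BroomChild F u v := by
    intro u v
    rcases u with a | ⟨l, j⟩ <;> rcases v with b | ⟨l', j'⟩ <;> simp [he, BroomChild, hswap]
  refine ⟨⟨e, fun {u v} => ?_⟩, .inr (i, ⟨0, by have := hF i; omega⟩), ?_⟩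
  · exact or_congr (hchild u v) (hchild v u)
  · simp [he, hne.symm]

section Rigid

/-- The first vertex of the handle has a larger degree than the others, so it is fixed. -/
theorem broom_aut_fixes_root [Fintype ι] (hp : 0 < p) (hι : 4 ≤ Fintype.card ι)
    (φ : broomGraph ι p m F hF ≃g broomGraph ι p m F hF) :
    φ (.inl ⟨0, hp⟩) = .inl ⟨0, hp⟩ := by
  classical
  by_contra hne
  set c : BroomVertex ι p m := .inl ⟨0, hp⟩ with hc
  have hd : broomDepth F (φ c) ≠ 0 := fun h => hne (eq_handle_zero_of_depth hp h)
  have hm : ∀ i, 0 < m := fun i => by have := hF i; omega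
  let rt : ι → BroomVertex ι p m := fun i => .inr (i, ⟨0, hm i⟩)
  have hadj : ∀ i, (broomGraph ι p m F hF).Adj (φ c) (φ (rt i)) := fun i =>
    φ.map_rel_iff.2 (Or.inl (by simp [hc, rt, BroomChild]))
  -- a neighbour is the parent, the leaf of a bristle, or the next vertex of a path
  let kind : BroomVertex ι p m → Fin 3 := fun u =>
    if BroomChild F u (φ c) then 0 else
      match u with
      | .inl _ => 1
      | .inr (_, j) => if j.val + 1 = m then 2 else 1
  have hkind : ∀ u u', (broomGraph ι p m F hF).Adj (φ c) u →
      (broomGraph ι p m F hF).Adj (φ c) u' → kind u = kind u' → u = u' := by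
    intro u u' hu hu' hk
    by_cases h1 : BroomChild F u (φ c)
    · by_cases h2 : BroomChild F u' (φ c)
      · exact broom_parent_unique hF h1 h2
      · rcases u' with b | ⟨i, j⟩
        · simp [kind, h1, h2] at hk
        · simp only [kind, h1, h2, if_true, if_false] at hk
          split_ifs at hk <;> simp at hk
    · by_cases h2 : BroomChild F u' (φ c)
      · rcases u with b | ⟨i, j⟩
        · simp [kind, h1, h2] at hk
        · simp only [kind, h1, h2, if_true, if_false] at hk
          split_ifs at hk <;> simp at hk
      · replace hu : BroomChild F (φ c) u := hu.resolve_right h1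
        replace hu' : BroomChild F (φ c) u' := hu'.resolve_right h2
        simp only [kind, h1, h2, if_false] at hk
        generalize φ c = v at *
        rcases v with a | ⟨i, j⟩
        · have ha : a.val ≠ 0 := hd
          rcases u with b | ⟨l, k⟩ <;> rcases u' with b' | ⟨l', k'⟩ <;>
            simp only [BroomChild] at hu hu' <;> try omega
          congr 1; ext; omega
        · rcases u with b | ⟨l, k⟩ <;> rcases u' with b' | ⟨l', k'⟩ <;>
            simp only [BroomChild] at hu hu'
          obtain ⟨rfl, hu⟩ := hu
          obtain ⟨rfl, hu'⟩ := hu'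
          have := k.isLt
          have := k'.isLt
          simp only [BristleChild] at hu hu'
          simp only at hk
          congr 2
          ext
          split_ifs at hk <;> omega
  have hinj : Function.Injective fun i => kind (φ (rt i)) := by
    intro i i' h
    have := φ.injective (hkind _ _ (hadj i) (hadj i') h)
    simpa [rt] using this
  have := Fintype.card_le_of_injective _ hinj
  simp at this
  omega

/-- Automorphisms preserve depth, since they fix the root. -/
theorem broom_aut_depth [Fintype ι] (hp : 0 < p) (hι : 4 ≤ Fintype.card ι) (d : ℕ) :
    ∀ (φ : broomGraph ι p m F hF ≃g broomGraph ι p m F hF) (v : BroomVertex ι p m),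
      broomDepth F v = d → broomDepth F (φ v) = d := by
  induction d using Nat.strong_induction_on with
  | _ d ih =>
    intro φ v hv
    rcases Nat.eq_zero_or_pos d with rfl | hd
    · rw [eq_handle_zero_of_depth hp hv, broom_aut_fixes_root hp hι]
      rfl
    · obtain ⟨u, hu⟩ := broom_exists_parent hF v (by omega) hp
      have h1 := broomDepth_of_child hF hu
      have h2 := ih (d - 1) (by omega) φ u (by omega)
      have hadj : (broomGraph ι p m F hF).Adj (φ u) (φ v) := φ.map_rel_iff.2 (Or.inl hu)
      rcases hadj with h | h
      · have := broomDepth_of_child hF h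
        omega
      · have h3 := broomDepth_of_child hF h
        have h4 := ih (d - 2) (by omega) φ.symm (φ v) (by omega)
        rw [RelIso.symm_apply_apply] at h4
        omega

theorem broom_aut_child [Fintype ι] (hp : 0 < p) (hι : 4 ≤ Fintype.card ι)
    (φ : broomGraph ι p m F hF ≃g broomGraph ι p m F hF) {u v : BroomVertex ι p m}
    (h : BroomChild F u v) : BroomChild F (φ u) (φ v) := by
  have hadj : (broomGraph ι p m F hF).Adj (φ u) (φ v) := φ.map_rel_iff.2 (Or.inl h)
  refine hadj.resolve_right fun h' => ?_
  have h1 := broomDepth_of_child hF h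
  have h2 := broomDepth_of_child hF h'
  have h3 := broom_aut_depth hp hι _ φ u rfl
  have h4 := broom_aut_depth hp hι _ φ v rfl
  omega

/-- Only the vertex of a bristle that carries the leaf has two children, apart from the root of
the broom. -/
theorem broom_two_children {u v w : BroomVertex ι p m} (hu : broomDepth F u ≠ 0)
    (hv : BroomChild F u v) (hw : BroomChild F u w) (hvw : v ≠ w) :
    ∃ i j, u = .inr (i, j) ∧ j.val = F i := by
  rcases u with a | ⟨i, j⟩
  · exfalso
    have ha : a.val ≠ 0 := hu
    rcases v with b | ⟨l, k⟩ <;> rcases w with b' | ⟨l', k'⟩ <;>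
      simp only [BroomChild] at hv hw <;> try omega
    exact hvw (by congr 1; ext; omega)
  · refine ⟨i, j, rfl, ?_⟩
    by_contra hj
    rcases v with b | ⟨l, k⟩ <;> rcases w with b' | ⟨l', k'⟩ <;>
      simp only [BroomChild, BristleChild] at hv hw
    obtain ⟨rfl, hv⟩ := hv
    obtain ⟨rfl, hw⟩ := hw
    exact hvw (by congr 2; ext; omega)

/-- The broom graph is asymmetric if its bristles are pairwise distinct. -/
theorem broomGraph_rigid [Fintype ι] (hp : 0 < p) (hι : 4 ≤ Fintype.card ι)
    (hinj : Function.Injective F) (φ : broomGraph ι p m F hF ≃g broomGraph ι p m F hF)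
    (v : BroomVertex ι p m) : φ v = v := by
  have hdep := fun v => broom_aut_depth hp hι _ φ v rfl
  have hch := fun {u v} => broom_aut_child hp hι φ (u := u) (v := v)
  -- the vertex that carries the leaf is fixed, since its depth determines the bristle
  have hbranch : ∀ i (h : F i < m), φ (.inr (i, ⟨F i, h⟩)) = .inr (i, ⟨F i, h⟩) := by
    intro i h
    have := hF i
    have hu0 : broomDepth F (p := p) (m := m) (.inr (i, ⟨F i, h⟩)) = F i + 1 := by
      simp only [broomDepth]
      rw [if_pos (by omega)]
    have c1 : BroomChild F (p := p) (m := m) (.inr (i, ⟨F i, h⟩))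
        (.inr (i, ⟨F i + 1, by omega⟩)) := ⟨rfl, Or.inl ⟨by simp only; omega, rfl⟩⟩
    have c2 : BroomChild F (p := p) (m := m) (.inr (i, ⟨F i, h⟩))
        (.inr (i, ⟨m - 1, by omega⟩)) := ⟨rfl, Or.inr ⟨by simp only; omega, rfl⟩⟩
    obtain ⟨i', j', hu, hj⟩ := broom_two_children (by rw [hdep, hu0]; omega) (hch c1) (hch c2)
      (by
        rw [φ.injective.ne_iff]
        simp
        omega)
    have h1 := hdep (.inr (i, ⟨F i, h⟩))
    rw [hu0, hu] at h1
    simp only [broomDepth] at h1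
    have := hF i'
    rw [if_pos (by omega)] at h1
    have hii : i' = i := hinj (by omega)
    subst hii
    rw [hu]
    congr 2
    ext
    exact hj
  -- hence so are its ancestors
  have hup : ∀ i d (j : Fin m), j.val + d = F i → φ (.inr (i, j)) = .inr (i, j) := by
    intro i d
    have := hF i
    induction d with
    | zero =>
      intro j hj
      have : j = ⟨F i, by omega⟩ := by ext; simpa using hj
      rw [this]
      exact hbranch i _
    | succ d ih =>
      intro j hj
      have hc : BroomChild F (p := p) (m := m) (.inr (i, j)) (.inr (i, ⟨j.val + 1, by omega⟩)) :=
        ⟨rfl, Or.inl ⟨by simp only; omega, rfl⟩⟩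
      have h1 := hch hc
      rw [ih ⟨j.val + 1, by omega⟩ (by simp only; omega)] at h1
      exact broom_parent_unique hF h1 hc
  have hroot : ∀ i (h : 0 < m), φ (.inr (i, ⟨0, h⟩)) = .inr (i, ⟨0, h⟩) :=
    fun i h => hup i (F i) _ (by simp)
  -- every bristle is mapped to itself
  have hbr : ∀ i d (j : Fin m), j.val = d → ∃ j', φ (.inr (i, j)) = .inr (i, j') := by
    intro i d
    have := hF i
    induction d using Nat.strong_induction_on with
    | _ d ih =>
      intro j hj
      rcases Nat.eq_zero_or_pos d with rfl | hd
      · refine ⟨j, ?_⟩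
        have : j = ⟨0, by omega⟩ := by ext; exact hj
        rw [this]
        exact hroot i _
      · obtain ⟨k, hk, hkj⟩ : ∃ k : Fin m, k.val < d ∧ BristleChild (F i) k j := by
          by_cases h1 : j.val + 1 < m
          · exact ⟨⟨j.val - 1, by omega⟩, by simp only; omega, Or.inl ⟨h1, by simp only; omega⟩⟩
          · exact ⟨⟨F i, by omega⟩, by simp only; omega, Or.inr ⟨by omega, rfl⟩⟩
        obtain ⟨k', hk'⟩ := ih k.val hk k rfl
        have h1 := hch (u := .inr (i, k)) (v := .inr (i, j)) ⟨rfl, hkj⟩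
        rw [hk'] at h1
        generalize φ (.inr (i, j)) = w at h1
        rcases w with a | ⟨i', j'⟩
        · exact h1.elim
        · exact ⟨j', by rw [h1.1]⟩
  have hpath : ∀ i (j : Fin m), j.val + 1 < m → φ (.inr (i, j)) = .inr (i, j) := by
    intro i j hj
    obtain ⟨j', hj'⟩ := hbr i _ j rfl
    have h1 := hdep (.inr (i, j))
    have := hF i
    rw [hj'] at h1 ⊢
    simp only [broomDepth, if_pos hj] at h1
    split_ifs at h1 with h2
    · congr 2; ext; omega
    · -- the leaf has the depth of `j`, but `j` has a child in this case
      exfalso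
      have hc : BroomChild F (p := p) (m := m) (.inr (i, j)) (.inr (i, ⟨j.val + 1, by omega⟩)) :=
        ⟨rfl, Or.inl ⟨by simp only; omega, rfl⟩⟩
      have h3 := hch hc
      rw [hj'] at h3
      generalize φ (.inr (i, ⟨j.val + 1, by omega⟩)) = w at h3
      rcases w with a | ⟨i', k⟩
      · exact h3
      · have := h3.2
        simp only [BristleChild] at this
        have := j'.isLt
        omega
  have hbristle : ∀ i (j : Fin m), φ (.inr (i, j)) = .inr (i, j) := by
    intro i j
    by_cases hj : j.val + 1 < m
    · exact hpath i j hj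
    · obtain ⟨j', hj'⟩ := hbr i _ j rfl
      by_cases h2 : j'.val + 1 < m
      · have h3 := φ.injective (hj'.trans (hpath i j' h2).symm)
        rw [Sum.inr.injEq, Prod.mk.injEq] at h3
        rw [← h3.2] at h2
        exact absurd h2 hj
      · rw [hj']
        congr 2
        ext
        have := j.isLt
        have := j'.isLt
        omega
  rcases v with a | ⟨i, j⟩
  · rcases h : φ (.inl a) with b | ⟨i, j⟩
    · have h1 := hdep (.inl a)
      rw [h] at h1
      congr 1
      ext
      exact h1
    · have := φ.injective (h.trans (hbristle i j).symm)
      simp at this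
  · exact hbristle i j

end Rigid

end Brooms

/-! ### Acceptance depends on the types of the bristles only -/

section Cut

/-- For fixed coins, the messages `msg u v w` from `u` to `v` when `u` has certificate `w`, and the
verdicts `ver v w M`, a graph is accepted if some choice of certificates in `W` makes all nodes
accept. -/
def LocallyAccepted {V : Type} (ident : V → ℕ) (W : Set (List Bool))
    (msg : V → V → List Bool → List Bool) (ver : V → List Bool → Set (ℕ × List Bool) → Prop)
    (G : SimpleGraph V) : Prop :=
  ∃ w : V → List Bool, (∀ v, w v ∈ W) ∧
    ∀ v, ver v (w v) {x | ∃ u, G.Adj v u ∧ x = (ident u, msg u v (w u))}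

variable {ι : Type} {p m : ℕ} (hp : 0 < p) (hm : 0 < m) (ident : BroomVertex ι p m → ℕ)
  (W : Set (List Bool))
  (msg : BroomVertex ι p m → BroomVertex ι p m → List Bool → List Bool)
  (ver : BroomVertex ι p m → List Bool → Set (ℕ × List Bool) → Prop)

/-- The type of the `i`-th bristle with parameter `f`: the pairs of a message sent by its root and a
message sent to its root for which Merlin can make the whole bristle accept. -/
def bristleType (i : ι) (f : ℕ) : Set (List Bool × List Bool) :=
  {ab | ∃ w : Fin m → List Bool, (∀ j, w j ∈ W) ∧
    ab.1 = msg (.inr (i, ⟨0, hm⟩)) (.inl ⟨0, hp⟩) (w ⟨0, hm⟩) ∧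
    ab.2 ∈ msg (.inl ⟨0, hp⟩) (.inr (i, ⟨0, hm⟩)) '' W ∧
    ∀ j, ver (.inr (i, j)) (w j)
      ({x | ∃ j', (BristleChild f j j' ∨ BristleChild f j' j) ∧
          x = (ident (.inr (i, j')), msg (.inr (i, j')) (.inr (i, j)) (w j'))} ∪
        {x | j.val = 0 ∧ x = (ident (.inl ⟨0, hp⟩), ab.2)})}

theorem bristleType_subset (i : ι) (f : ℕ) :
    bristleType hp hm ident W msg ver i f ⊆
      (msg (.inr (i, ⟨0, hm⟩)) (.inl ⟨0, hp⟩) '' W) ×ˢ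
        (msg (.inl ⟨0, hp⟩) (.inr (i, ⟨0, hm⟩)) '' W) := by
  rintro ⟨a, b⟩ ⟨w, hw, ha, hb, -⟩
  exact ⟨⟨_, hw _, ha.symm⟩, hb⟩

variable {F F' : ι → ℕ} (hF : ∀ i, F i + 4 ≤ m) (hF' : ∀ i, F' i + 4 ≤ m)

theorem received_in_bristle (w : BroomVertex ι p m → List Bool) (i : ι) (j : Fin m) :
    {x | ∃ u, (broomGraph ι p m F hF).Adj (.inr (i, j)) u ∧
        x = (ident u, msg u (.inr (i, j)) (w u))} =
      {x | ∃ j', (BristleChild (F i) j j' ∨ BristleChild (F i) j' j) ∧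
          x = (ident (.inr (i, j')), msg (.inr (i, j')) (.inr (i, j)) (w (.inr (i, j'))))} ∪
        {x | j.val = 0 ∧ x = (ident (.inl ⟨0, hp⟩),
          msg (.inl ⟨0, hp⟩) (.inr (i, ⟨0, hm⟩)) (w (.inl ⟨0, hp⟩)))} := by
  ext x
  constructor
  · rintro ⟨u, hu, rfl⟩
    rcases u with a | ⟨i', j'⟩
    · have h : a.val = 0 ∧ j.val = 0 := hu.resolve_left id
      obtain rfl : a = ⟨0, hp⟩ := Fin.ext h.1
      obtain rfl : j = ⟨0, hm⟩ := Fin.ext h.2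
      exact Or.inr ⟨rfl, rfl⟩
    · rcases hu with ⟨rfl, h⟩ | ⟨rfl, h⟩
      · exact Or.inl ⟨j', Or.inl h, rfl⟩
      · exact Or.inl ⟨j', Or.inr h, rfl⟩
  · rintro (⟨j', h, rfl⟩ | ⟨h, rfl⟩)
    · exact ⟨.inr (i, j'), h.imp (fun h => ⟨rfl, h⟩) (fun h => ⟨rfl, h⟩), rfl⟩
    · obtain rfl : j = ⟨0, hm⟩ := Fin.ext h
      exact ⟨.inl ⟨0, hp⟩, Or.inr ⟨rfl, rfl⟩, rfl⟩

/-- Bristles may be replaced by bristles of the same type: Merlin keeps the certificates of the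
handle, and hence the messages that cross the cuts. -/
theorem LocallyAccepted.replace_bristles
    (h : ∀ i, bristleType hp hm ident W msg ver i (F i) =
      bristleType hp hm ident W msg ver i (F' i))
    (hacc : LocallyAccepted ident W msg ver (broomGraph ι p m F hF)) :
    LocallyAccepted ident W msg ver (broomGraph ι p m F' hF') := by
  obtain ⟨w, hw, hver⟩ := hacc
  have htype : ∀ i, (msg (.inr (i, ⟨0, hm⟩)) (.inl ⟨0, hp⟩) (w (.inr (i, ⟨0, hm⟩))),
      msg (.inl ⟨0, hp⟩) (.inr (i, ⟨0, hm⟩)) (w (.inl ⟨0, hp⟩))) ∈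
        bristleType hp hm ident W msg ver i (F' i) := by
    intro i
    rw [← h]
    refine ⟨fun j => w (.inr (i, j)), fun j => hw _, rfl, ⟨_, hw _, rfl⟩, fun j => ?_⟩
    have := hver (.inr (i, j))
    rwa [received_in_bristle hp hm] at this
  choose w' hw' hroot _ hver' using htype
  let W' : BroomVertex ι p m → List Bool := Sum.elim (fun a => w (.inl a)) (fun q => w' q.1 q.2)
  refine ⟨W', ?_, ?_⟩
  · rintro (a | ⟨i, j⟩)
    · exact hw _
    · exact hw' i j
  · rintro (a | ⟨i, j⟩)
    · have h1 := hver (.inl a)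
      have h2 : {x | ∃ u, (broomGraph ι p m F hF).Adj (.inl a) u ∧
            x = (ident u, msg u (.inl a) (w u))} =
          {x | ∃ u, (broomGraph ι p m F' hF').Adj (.inl a) u ∧
            x = (ident u, msg u (.inl a) (W' u))} := by
        ext x
        refine exists_congr fun u => ?_
        rcases u with b | ⟨i, j⟩
        · exact Iff.rfl
        · have hadj : (broomGraph ι p m F hF).Adj (.inl a) (.inr (i, j)) ↔
              a.val = 0 ∧ j.val = 0 := or_iff_left id
          have hadj' : (broomGraph ι p m F' hF').Adj (.inl a) (.inr (i, j)) ↔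
              a.val = 0 ∧ j.val = 0 := or_iff_left id
          rw [hadj, hadj']
          refine and_congr_right fun h0 => ?_
          obtain rfl : a = ⟨0, hp⟩ := Fin.ext h0.1
          obtain rfl : j = ⟨0, hm⟩ := Fin.ext h0.2
          have h3 := hroot i
          simp only at h3
          rw [h3]
          rfl
      rw [h2] at h1
      exact h1
    · rw [received_in_bristle hp hm]
      exact hver' i j

open Classical in
/-- With at most `B` messages across each cut in each direction there are at most `2 ^ (B * B)`
types. -/
theorem card_image_bristleType_le {U : Type*} [Fintype U] (g : U → ℕ) {B : ℕ}
    (hB : ∀ u v, (msg u v '' W).Finite ∧ (msg u v '' W).ncard ≤ B) (i : ι) :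
    (Finset.univ.image fun u => bristleType hp hm ident W msg ver i (g u)).card ≤
      2 ^ (B * B) := by
  set S := (msg (.inr (i, ⟨0, hm⟩)) (.inl ⟨0, hp⟩) '' W) ×ˢ
        (msg (.inl ⟨0, hp⟩) (.inr (i, ⟨0, hm⟩)) '' W) with hS
  have hSf : S.Finite := (hB _ _).1.prod (hB _ _).1
  have hScard : S.ncard ≤ B * B := by
    rw [hS, Set.ncard_prod]
    exact Nat.mul_le_mul (hB _ _).2 (hB _ _).2
  calc _ = ((Finset.univ.image fun u => bristleType hp hm ident W msg ver i (g u) :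
            Finset (Set (List Bool × List Bool))) : Set (Set (List Bool × List Bool))).ncard :=
        (Set.ncard_coe_finset _).symm
    _ ≤ (𝒫 S).ncard := by
        refine Set.ncard_le_ncard ?_ hSf.powerset
        intro T hT
        simp only [Finset.coe_image, Set.mem_image] at hT
        obtain ⟨u, -, rfl⟩ := hT
        exact bristleType_subset ..
    _ = 2 ^ S.ncard := Set.ncard_powerset S hSf
    _ ≤ 2 ^ (B * B) := Nat.pow_le_pow_right (by norm_num) hScard

end Cut

/-! ### Coins and probabilities -/

section Protocol

theorem finite_coins (R : Randomness) {V : Type} [Finite V] (ρ : ℕ) : Finite (Coins R V ρ) := by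
  cases R <;> unfold Coins <;> infer_instance

theorem nonempty_coins (R : Randomness) (V : Type) (ρ : ℕ) : Nonempty (Coins R V ρ) := by
  cases R
  · exact ⟨fun _ => false⟩
  · exact ⟨fun _ _ => false⟩

theorem uniformProb_mono {Ω : Type} [Finite Ω] {E E' : Ω → Prop} (h : ∀ ω, E ω → E' ω) :
    uniformProb E ≤ uniformProb E' := by
  unfold uniformProb
  gcongr
  exact Nat.card_le_card_of_injective (fun x : {ω // E ω} => (⟨x.1, h _ x.2⟩ : {ω // E' ω}))
    fun x y hxy => Subtype.ext (by simpa using hxy)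

open Classical in
theorem uniformProb_eq_sum {Ω : Type} [Fintype Ω] (E : Ω → Prop) :
    uniformProb E = (∑ ω, if E ω then 1 else 0) / Fintype.card Ω := by
  rw [uniformProb, Nat.card_eq_fintype_card, Nat.card_eq_fintype_card, Fintype.card_subtype]
  simp

theorem uniformProb_not {Ω : Type} [Finite Ω] [Nonempty Ω] (E : Ω → Prop) :
    uniformProb (fun ω => ¬ E ω) = 1 - uniformProb E := by
  classical
  have := Fintype.ofFinite Ω
  have h0 : (Fintype.card Ω : ℝ) ≠ 0 := by exact_mod_cast Fintype.card_ne_zero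
  rw [uniformProb_eq_sum, uniformProb_eq_sum, eq_sub_iff_add_eq, ← add_div,
    ← Finset.sum_add_distrib, div_eq_one_iff_eq h0]
  rw [Finset.sum_congr rfl (g := fun _ => (1 : ℝ)) (fun ω _ => by by_cases h : E ω <;> simp [h])]
  simp

/-! ### Types and the acceptance probability -/

open Classical in
/-- A test that accepts the planted tuples with probability at least `2 / 3`, and the injective ones
with probability at most `1 / 3`, separates planted from random tuples. The hypothesis on the
cardinality makes the probability of a collision in a random tuple at most `1 / 12`. -/
theorem planted_gap {κ U : Type} [Fintype κ] [DecidableEq κ] [Fintype U] [Nonempty U]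
    (hU : 48 * Fintype.card κ ^ 2 ≤ Fintype.card U) (q : (κ × Bool → U) → ℝ)
    (hq1 : ∀ F, q F ≤ 1)
    (hplant : ∀ t F, 2 / 3 ≤ q (Function.update F (t, true) (F (t, false))))
    (hinj : ∀ F, Function.Injective F → q F ≤ 1 / 3) :
    Fintype.card κ * (Fintype.card (κ × Bool → U) : ℝ) / 4 ≤
      ∑ t, (∑ F, q (Function.update F (t, true) (F (t, false))) - ∑ F, q F) := by
  set N : ℝ := (Fintype.card (κ × Bool → U) : ℝ) with hN
  have hN0 : 0 ≤ N := Nat.cast_nonneg _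
  have hbad : ∑ F : κ × Bool → U, (if Function.Injective F then (0 : ℝ) else 1) ≤ N / 12 := by
    have h1 := card_not_injective_le (U := U) (ι := κ × Bool)
    rw [← hN, Fintype.card_prod, Fintype.card_bool] at h1
    have h2 : (48 : ℝ) * Fintype.card κ ^ 2 ≤ Fintype.card U := by exact_mod_cast hU
    have h3 : (0 : ℝ) < Fintype.card U := by exact_mod_cast Fintype.card_pos
    push_cast at h1
    refine le_of_mul_le_mul_left (h1.trans ?_) h3
    nlinarith
  have h1 : ∀ t, N / 4 ≤ ∑ F, q (Function.update F (t, true) (F (t, false))) - ∑ F, q F := by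
    intro t
    have h2 : ∑ _F : κ × Bool → U, (2 / 3 : ℝ) ≤
        ∑ F, q (Function.update F (t, true) (F (t, false))) :=
      Finset.sum_le_sum fun F _ => hplant t F
    have h3 : ∑ F, q F ≤ ∑ F : κ × Bool → U,
        (1 / 3 + if Function.Injective F then (0 : ℝ) else 1) := by
      refine Finset.sum_le_sum fun F _ => ?_
      split_ifs with h
      · rw [add_zero]
        exact hinj F h
      · linarith [hq1 F]
    rw [Finset.sum_add_distrib] at h3
    simp only [Finset.sum_const, Finset.card_univ, nsmul_eq_mul, ← hN] at h2 h3
    linarith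
  calc _ = ∑ _t : κ, N / 4 := by
        simp
        ring
    _ ≤ _ := Finset.sum_le_sum fun t _ => h1 t

open Classical in
/-- If the acceptance of a tuple depends, for each outcome `r` of the coins, on the types of its
coordinates only, and the acceptance probability distinguishes the injective tuples from the planted
ones, then the number of types is at least about the square root of the number of pairs. -/
theorem card_le_of_distinguishes {Ω κ U : Type} {T : Type*} [Finite Ω] [Nonempty Ω] [Fintype κ]
    [DecidableEq κ] [Nonempty κ] [Fintype U] [Nonempty U]
    (hU : 48 * Fintype.card κ ^ 2 ≤ Fintype.card U) {D : ℕ} (X : Ω → κ × Bool → U → T)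
    (hX : ∀ r i, (Finset.univ.image (X r i)).card ≤ D) (acc : (κ × Bool → U) → Ω → Prop)
    (hacc : ∀ r F F', (∀ i, X r i (F i) = X r i (F' i)) → acc F r → acc F' r)
    (h : ((∀ t F, 2 / 3 ≤ uniformProb (acc (Function.update F (t, true) (F (t, false))))) ∧
        ∀ F, Function.Injective F → uniformProb (acc F) ≤ 1 / 3) ∨
      ((∀ t F, uniformProb (acc (Function.update F (t, true) (F (t, false)))) ≤ 1 / 3) ∧
        ∀ F, Function.Injective F → 2 / 3 ≤ uniformProb (acc F))) :
    Fintype.card κ ≤ 16 * D ^ 2 := by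
  have := Fintype.ofFinite Ω
  let f : Ω → (κ × Bool → U) → ℝ := fun r F => if acc F r then 1 else 0
  let q : (κ × Bool → U) → ℝ := fun F => uniformProb (acc F)
  have hq : ∀ F, q F = (∑ r, f r F) / Fintype.card Ω := fun F => uniformProb_eq_sum _
  set N : ℝ := (Fintype.card (κ × Bool → U) : ℝ) with hN
  have hN0 : 0 < N := by
    rw [hN]
    exact_mod_cast Fintype.card_pos
  set k : ℝ := (Fintype.card κ : ℝ) with hk
  have hk0 : 0 < k := by
    rw [hk]
    exact_mod_cast Fintype.card_pos
  have hΩ : (0 : ℝ) < Fintype.card Ω := by exact_mod_cast Fintype.card_pos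
  have hf0 : ∀ r F, 0 ≤ f r F := fun r F => by
    simp only [f]
    split_ifs <;> norm_num
  have hf1 : ∀ r F, f r F ≤ 1 := fun r F => by
    simp only [f]
    split_ifs <;> norm_num
  have hq0 : ∀ F, 0 ≤ q F := fun F => by
    rw [hq]
    exact div_nonneg (Finset.sum_nonneg fun r _ => hf0 r F) hΩ.le
  have hq1 : ∀ F, q F ≤ 1 := fun F => by
    rw [hq, div_le_one hΩ]
    calc ∑ r, f r F ≤ ∑ _r : Ω, (1 : ℝ) := Finset.sum_le_sum fun r _ => hf1 r F
      _ = _ := by simp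
  -- for each outcome of the coins, planting is not noticed
  have hr : ∀ r, |∑ t, (∑ F, f r (Function.update F (t, true) (F (t, false))) - ∑ F, f r F)| ≤
      √k * D * N := by
    intro r
    refine abs_le_of_sq_le_sq ?_ (by positivity)
    rw [mul_pow, mul_pow, Real.sq_sqrt hk0.le]
    refine sq_sum_planted_sub_le (X r) (fun i => by exact_mod_cast hX r i) (f r) (hf0 r) (hf1 r)
      fun F F' h => ?_
    have : acc F r ↔ acc F' r := ⟨hacc r F F' h, hacc r F' F fun i => (h i).symm⟩
    simp only [f, this]
  have hbound : |∑ t, (∑ F, q (Function.update F (t, true) (F (t, false))) - ∑ F, q F)| ≤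
      √k * D * N := by
    have h1 : ∑ t, (∑ F, q (Function.update F (t, true) (F (t, false))) - ∑ F, q F) =
        (∑ r, ∑ t, (∑ F, f r (Function.update F (t, true) (F (t, false))) - ∑ F, f r F)) /
          Fintype.card Ω := by
      simp_rw [hq, ← Finset.sum_div, ← sub_div, ← Finset.sum_div]
      congr 1
      refine Eq.trans (Finset.sum_congr rfl fun t _ => ?_) Finset.sum_comm
      rw [Finset.sum_sub_distrib]
      congr 1 <;> exact Finset.sum_comm
    rw [h1, abs_div, abs_of_pos hΩ, div_le_iff₀ hΩ]
    calc _ ≤ ∑ r, |∑ t, (∑ F, f r (Function.update F (t, true) (F (t, false))) - ∑ F, f r F)| :=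
          Finset.abs_sum_le_sum_abs _ _
      _ ≤ ∑ _r : Ω, √k * D * N := Finset.sum_le_sum fun r _ => hr r
      _ = _ := by
        simp
        ring
  have hgap : k * N / 4 ≤
      |∑ t, (∑ F, q (Function.update F (t, true) (F (t, false))) - ∑ F, q F)| := by
    rcases h with ⟨hp, hi⟩ | ⟨hp, hi⟩
    · exact (planted_gap hU q hq1 hp hi).trans (le_abs_self _)
    · refine le_trans ?_ (neg_le_abs _)
      refine (planted_gap hU (fun F => 1 - q F) (fun F => by linarith [hq0 F])
        (fun t F => by linarith [hp t F]) (fun F hF => by linarith [hi F hF])).trans ?_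
      rw [← Finset.sum_neg_distrib]
      refine (Finset.sum_congr rfl fun t _ => ?_).le
      rw [Finset.sum_sub_distrib, Finset.sum_sub_distrib]
      ring
  have h1 : √k * √k = k := Real.mul_self_sqrt hk0.le
  have h2 : 0 < √k := Real.sqrt_pos.2 hk0
  have h3 : √k ≤ 4 * D := by
    have h4 : (√k * N) * √k ≤ (√k * N) * (4 * D) := by
      have := hgap.trans hbound
      nlinarith
    exact le_of_mul_le_mul_left h4 (by positivity)
  have h5 : k ≤ 16 * (D : ℝ) ^ 2 := by nlinarith
  rw [hk] at h5
  exact_mod_cast h5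

/-! ### Protocols on broom graphs -/

variable {c : ℕ} (P : AMVerifier) (R : Randomness) (I : NetworkConfig c) (s : ℕ∞)

/-- Merlin has certificates of at most `s` bits that make all nodes accept, for coins `r`. -/
def Convincible (r : P.CoinsOn R I) : Prop :=
  LocallyAccepted I.ident {w | (w.length : ℕ∞) ≤ s}
    (fun u v w => P.message I.size (I.ident u) (I.ident v) (I.label u) (coinsAt R r u) w)
    (fun v w M => P.accept I.size (I.ident v) (I.label v) (coinsAt R r v) w M) I.graph

theorem le_uniformProb_convincible
    (h : ∃ p : P.Prover R I, p.BoundedBy s ∧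
      2 / 3 ≤ uniformProb fun r => ∀ v, P.AcceptsAt R I r (p r) v) :
    2 / 3 ≤ uniformProb (Convincible P R I s) := by
  obtain ⟨p, hp, h⟩ := h
  have := I.finite
  have := finite_coins R (V := I.V) (P.ρ I.size)
  exact h.trans (uniformProb_mono fun r hr => ⟨p r, hp r, hr⟩)

theorem uniformProb_convincible_le
    (h : ∀ p : P.Prover R I, p.BoundedBy s →
      2 / 3 ≤ uniformProb fun r => ∃ v, ¬ P.AcceptsAt R I r (p r) v) :
    uniformProb (Convincible P R I s) ≤ 1 / 3 := by
  classical
  have := I.finite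
  have := finite_coins R (V := I.V) (P.ρ I.size)
  have := nonempty_coins R I.V (P.ρ I.size)
  -- the optimal strategy convinces all nodes whenever this is possible
  let p : P.Prover R I := fun r => if h : Convincible P R I s r then h.choose else fun _ => []
  have hp : p.BoundedBy s := by
    intro r v
    by_cases hr : Convincible P R I s r
    · simp only [p, dif_pos hr]
      exact hr.choose_spec.1 v
    · simp [p, dif_neg hr]
  have h1 := (h p hp).trans (uniformProb_mono (E' := fun r => ¬ Convincible P R I s r) (by
    rintro r ⟨v, hv⟩ hr
    refine hv ?_
    simp only [p, dif_pos hr]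
    exact hr.choose_spec.2 v))
  have h2 := uniformProb_not (Convincible P R I s)
  linarith

/-- The configuration of a broom graph, with identities that do not depend on the bristles and with
empty labels. -/
noncomputable def broomConfig (hc : 1 ≤ c) (ι : Type) [Finite ι] {p : ℕ} (m : ℕ) (hp : 0 < p)
    (F : ι → ℕ) (hF : ∀ i, F i + 4 ≤ m) : NetworkConfig c where
  V := BroomVertex ι p m
  finite := inferInstance
  graph := broomGraph ι p m F hF
  connected := broomGraph_connected hp
  ident v := (Finite.equivFin (BroomVertex ι p m) v).val + 1
  ident_injective u v h := (Finite.equivFin (BroomVertex ι p m)).injective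
    (Fin.ext (Nat.succ_injective h))
  ident_mem v := by
    refine ⟨Nat.le_add_left _ _, ?_⟩
    calc _ ≤ Nat.card (BroomVertex ι p m) := (Finite.equivFin (BroomVertex ι p m) v).isLt
      _ ≤ _ := Nat.le_self_pow (by omega) _
  label _ := []

/-- A protocol that decides, up to complement, the symmetry of the broom graphs with `k` pairs of
bristles has at least about `√k` types of bristles. -/
theorem card_pairs_le (hc : 1 ≤ c) {L : DistributedLanguage c}
    (hL : L = SymLang c ∨ L = (SymLang c)ᶜ) {k M p B : ℕ} (hp : 0 < p) (hk : 2 ≤ k)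
    (hM : 48 * k ^ 2 ≤ M)
    (hP : ∀ I : NetworkConfig c, I.size = Nat.card (BroomVertex (Fin k × Bool) p (M + 3)) →
      (I ∈ L → ∃ p : P.Prover R I, p.BoundedBy s ∧
        2 / 3 ≤ uniformProb fun r => ∀ v, P.AcceptsAt R I r (p r) v) ∧
      (I ∉ L → ∀ p : P.Prover R I, p.BoundedBy s →
        2 / 3 ≤ uniformProb fun r => ∃ v, ¬ P.AcceptsAt R I r (p r) v))
    (hB : ∀ i j r,
      (P.message (Nat.card (BroomVertex (Fin k × Bool) p (M + 3))) i j [] r ''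
        {w | (w.length : ℕ∞) ≤ s}).Finite ∧
      (P.message (Nat.card (BroomVertex (Fin k × Bool) p (M + 3))) i j [] r ''
        {w | (w.length : ℕ∞) ≤ s}).ncard ≤ B) :
    k ≤ 16 * (2 ^ (B * B)) ^ 2 := by
  have hm : 0 < M + 3 := by omega
  have hM0 : 0 < M := lt_of_lt_of_le (by positivity) hM
  have : Nonempty (Fin M) := ⟨⟨0, hM0⟩⟩
  have hF : ∀ (F : Fin k × Bool → Fin M) i, (F i).val + 4 ≤ M + 3 := fun F i => by
    have := (F i).isLt
    omega
  let I : (Fin k × Bool → Fin M) → NetworkConfig c := fun F =>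
    broomConfig hc (Fin k × Bool) (M + 3) hp (fun i => (F i).val) (hF F)
  let V := BroomVertex (Fin k × Bool) p (M + 3)
  let Ω : Type := Coins R V (P.ρ (Nat.card V))
  have : Finite Ω := finite_coins R _
  have : Nonempty Ω := nonempty_coins R _ _
  have : Nonempty (Fin k) := ⟨⟨0, by omega⟩⟩
  let idt : V → ℕ := fun v => (Finite.equivFin V v).val + 1
  let msg : Ω → V → V → List Bool → List Bool := fun r u v w =>
    P.message (Nat.card V) (idt u) (idt v) [] (coinsAt R r u) w
  let ver : Ω → V → List Bool → Set (ℕ × List Bool) → Prop := fun r v w Ms =>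
    P.accept (Nat.card V) (idt v) [] (coinsAt R r v) w Ms
  have hplant : ∀ t F, I (Function.update F (t, true) (F (t, false))) ∈ SymLang c := fun t F =>
    broomGraph_symmetric (i := (t, false)) (i' := (t, true)) (hF := hF _) (by simp) (by simp)
  have hasym : ∀ F, Function.Injective F → I F ∉ SymLang c := by
    rintro F hinj ⟨φ, v, hv⟩
    have hcard : 4 ≤ Fintype.card (Fin k × Bool) := by
      rw [Fintype.card_prod, Fintype.card_fin, Fintype.card_bool]
      omega
    exact hv (broomGraph_rigid (hF := hF F) hp hcard (Fin.val_injective.comp hinj) φ v)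
  have h := card_le_of_distinguishes (Ω := Ω) (κ := Fin k) (U := Fin M) (D := 2 ^ (B * B))
    (by simpa using hM)
    (fun r i u => bristleType hp hm idt {w | (w.length : ℕ∞) ≤ s} (msg r) (ver r) i u.val)
    (fun r i => card_image_bristleType_le hp hm idt _ (msg r) (ver r) (fun u : Fin M => u.val)
      (fun _ _ => hB _ _ _) i)
    (fun F => Convincible P R (I F) s)
    (fun r F F' h => LocallyAccepted.replace_bristles hp hm _ _ _ _ (hF F) (hF F') h)
    (by
      rcases hL with rfl | rfl
      · exact Or.inl ⟨fun t F => le_uniformProb_convincible P R _ s ((hP (I _) rfl).1 (hplant t F)),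
          fun F h => uniformProb_convincible_le P R _ s ((hP (I _) rfl).2 (hasym F h))⟩
      · exact Or.inr ⟨fun t F => uniformProb_convincible_le P R _ s
            ((hP (I _) rfl).2 (fun h => h (hplant t F))),
          fun F h => le_uniformProb_convincible P R _ s ((hP (I _) rfl).1 (hasym F h))⟩)
  rwa [Fintype.card_fin] at h

end Protocol

/-! ### From types to certificate and message size -/

section Bounds

theorem finite_ncard_length_le (s : ℕ) :
    {w : List Bool | w.length ≤ s}.Finite ∧ {w : List Bool | w.length ≤ s}.ncard ≤ 2 ^ (s + 1) := by
  have hfin : ∀ s : ℕ, {w : List Bool | w.length ≤ s}.Finite := List.finite_length_le Bool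
  suffices h : ∀ s : ℕ, {w : List Bool | w.length ≤ s}.ncard + 1 ≤ 2 ^ (s + 1) from
    ⟨hfin s, by have := h s; omega⟩
  intro s
  induction s with
  | zero =>
    have : {w : List Bool | w.length ≤ 0} = {[]} := by
      ext w
      simp
    rw [this]
    simp
  | succ s ih =>
    have hsub : {w : List Bool | w.length ≤ s + 1} ⊆
        {[]} ∪ (List.cons true '' {w | w.length ≤ s} ∪ List.cons false '' {w | w.length ≤ s}) := by
      rintro (_ | ⟨b, w⟩) hw
      · exact Or.inl rfl
      · have hw' : w.length ≤ s := by simpa using hw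
        cases b
        · exact Or.inr (Or.inr ⟨w, hw', rfl⟩)
        · exact Or.inr (Or.inl ⟨w, hw', rfl⟩)
    have hf1 := (hfin s).image (List.cons true)
    have hf2 := (hfin s).image (List.cons false)
    have h1 := Set.ncard_le_ncard hsub ((Set.finite_singleton _).union (hf1.union hf2))
    have h2 := Set.ncard_union_le {([] : List Bool)}
      (List.cons true '' {w | w.length ≤ s} ∪ List.cons false '' {w | w.length ≤ s})
    have h3 := Set.ncard_union_le (List.cons true '' {w | w.length ≤ s})
      (List.cons false '' {w | w.length ≤ s})
    have h4 := Set.ncard_image_le (f := List.cons true) (hfin s)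
    have h5 := Set.ncard_image_le (f := List.cons false) (hfin s)
    have h6 := Set.ncard_singleton ([] : List Bool)
    rw [pow_succ]
    omega

/-- A bound on the certificates as well as a bound on the messages limits the number of possible
messages. -/
theorem finite_ncard_messages_le {P : AMVerifier} {σ γ : ℕ → ℕ∞} (hP : P.MessagesBoundedBy σ γ)
    {n s : ℕ} (hs : σ n = s ∨ γ n = s) (i j : ℕ) (x : List Bool) (r : Fin (P.ρ n) → Bool) :
    (P.message n i j x r '' {w | (w.length : ℕ∞) ≤ σ n}).Finite ∧
      (P.message n i j x r '' {w | (w.length : ℕ∞) ≤ σ n}).ncard ≤ 2 ^ (s + 1) := by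
  obtain ⟨hf, hc⟩ := finite_ncard_length_le s
  rcases hs with hs | hs
  · have : {w : List Bool | (w.length : ℕ∞) ≤ σ n} = {w | w.length ≤ s} := by
      ext w
      simp [hs]
    rw [this]
    exact ⟨hf.image _, (Set.ncard_image_le hf).trans hc⟩
  · have : P.message n i j x r '' {w | (w.length : ℕ∞) ≤ σ n} ⊆ {w | w.length ≤ s} := by
      rintro _ ⟨w, hw, rfl⟩
      have := hP n i j x r w hw
      rw [hs] at this
      exact_mod_cast this
    exact ⟨hf.subset this, (Set.ncard_le_ncard this hf).trans hc⟩

/-- On `n` nodes there is room for about `n ^ (1 / 4)` pairs of bristles. -/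
theorem lt_of_mem_dAM {c : ℕ} (hc : 1 ≤ c) {R : Randomness} {σ γ : ℕ → ℕ∞}
    {L : DistributedLanguage c} (hL : L = SymLang c ∨ L = (SymLang c)ᶜ) (hmem : L ∈ dAM R σ γ)
    {n s : ℕ} (hn : 100 ^ 4 ≤ n) (hs : σ n = s ∨ γ n = s) :
    n < (16 * (2 ^ (2 ^ (s + 1) * 2 ^ (s + 1))) ^ 2 + 1) ^ 4 := by
  obtain ⟨P, hmsg, hP⟩ := hmem
  set k := n.sqrt.sqrt with hk
  have hk4 : k ^ 4 ≤ n := by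
    have h1 : k * k ≤ n.sqrt := Nat.sqrt_le _
    have h2 : n.sqrt * n.sqrt ≤ n := Nat.sqrt_le _
    calc k ^ 4 = (k * k) * (k * k) := by ring
      _ ≤ n.sqrt * n.sqrt := Nat.mul_le_mul h1 h1
      _ ≤ n := h2
  have hk4' : n < (k + 1) ^ 4 := by
    have h1 : n.sqrt < (k + 1) * (k + 1) := Nat.lt_succ_sqrt _
    have h2 : n < (n.sqrt + 1) * (n.sqrt + 1) := Nat.lt_succ_sqrt _
    calc n < (n.sqrt + 1) * (n.sqrt + 1) := h2
      _ ≤ ((k + 1) * (k + 1)) * ((k + 1) * (k + 1)) := Nat.mul_le_mul h1 h1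
      _ = _ := by ring
  have hk100 : 100 ≤ k := by
    have h1 : 100 * 100 ≤ n.sqrt := Nat.le_sqrt.2 (by omega)
    exact Nat.le_sqrt.2 h1
  -- the number of vertices in the bristles; the handle takes up the remaining ones
  set b := 2 * k * (48 * k ^ 2 + 3) with hb
  have hbn : b < n := by
    refine lt_of_lt_of_le ?_ hk4
    have h1 : 100 * k ^ 3 ≤ k ^ 4 := by
      calc 100 * k ^ 3 ≤ k * k ^ 3 := Nat.mul_le_mul_right _ hk100
        _ = k ^ 4 := by ring
    have h2 : 2 * k < k ^ 3 := by nlinarith [Nat.mul_le_mul hk100 hk100]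
    have h3 : b = 96 * k ^ 3 + 3 * (2 * k) := by rw [hb]; ring
    omega
  have hcard : Nat.card (BroomVertex (Fin k × Bool) (n - b) (48 * k ^ 2 + 3)) = n := by
    have h1 : Nat.card (BroomVertex (Fin k × Bool) (n - b) (48 * k ^ 2 + 3)) = (n - b) + b := by
      rw [Nat.card_eq_fintype_card]
      simp only [Fintype.card_sum, Fintype.card_prod, Fintype.card_fin, Fintype.card_bool]
      rw [hb]
      ring
    omega
  have h := card_pairs_le P R (σ n) hc hL (k := k) (M := 48 * k ^ 2) (p := n - b)
    (B := 2 ^ (s + 1)) (by omega) (by omega) le_rfl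
    (fun I hI => by
      have := hP I
      rwa [hI, hcard] at this)
    (by
      rw [hcard]
      exact fun i j r => finite_ncard_messages_le hmsg hs i j [] r)
  exact hk4'.trans_le (Nat.pow_le_pow_left (by omega) 4)

theorem log_log_le {n s : ℕ} (hn : 1 < n) (hlog : 2 * Real.log 100 ≤ Real.log (Real.log n))
    (h : n < (16 * (2 ^ (2 ^ (s + 1) * 2 ^ (s + 1))) ^ 2 + 1) ^ 4) :
    1 / 4 * Real.log (Real.log n) ≤ s := by
  have hlog2 : Real.log 2 < 0.6931471808 := Real.log_two_lt_d9
  have hlog2' : 0 < Real.log 2 := Real.log_pos (by norm_num)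
  obtain ⟨e, he⟩ : ∃ e, e = 2 ^ (s + 1) * 2 ^ (s + 1) := ⟨_, rfl⟩
  rw [← he] at h
  have he4 : e = 4 * 4 ^ s := by
    rw [he, ← mul_pow, pow_succ]
    ring
  have h1 : n ≤ 2 ^ (20 + 8 * e) := by
    refine h.le.trans ?_
    have h2 : 1 ≤ (2 ^ e) ^ 2 := Nat.one_le_two_pow.trans (Nat.le_self_pow (by norm_num) _)
    calc (16 * (2 ^ e) ^ 2 + 1) ^ 4 ≤ (32 * (2 ^ e) ^ 2) ^ 4 :=
          Nat.pow_le_pow_left (by omega) 4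
      _ = 2 ^ (20 + 8 * e) := by
          rw [pow_add, pow_mul, mul_pow, ← pow_mul, ← pow_mul, ← pow_mul,
            show e * (2 * 4) = 8 * e by ring, pow_mul]
          norm_num
  have hn0 : (0 : ℝ) < n := by positivity
  have h3 : Real.log n ≤ (20 + 8 * e : ℕ) * Real.log 2 := by
    rw [← Real.log_pow]
    exact Real.log_le_log hn0 (by exact_mod_cast h1)
  have h5 : (1 : ℝ) ≤ 4 ^ s := one_le_pow₀ (by norm_num)
  have h4 : Real.log n ≤ 100 * 4 ^ s := by
    rw [he4] at h3
    push_cast at h3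
    nlinarith
  have hlogn : 0 < Real.log n := Real.log_pos (by exact_mod_cast hn)
  have h6 : Real.log (Real.log n) ≤ Real.log 100 + s * Real.log 4 := by
    rw [← Real.log_pow, ← Real.log_mul (by norm_num) (by positivity)]
    exact Real.log_le_log hlogn h4
  have h7 : Real.log 4 = 2 * Real.log 2 := by
    rw [show (4 : ℝ) = 2 ^ 2 by norm_num, Real.log_pow]
    norm_num
  rw [h7] at h6
  have hs0 : (0 : ℝ) ≤ s := Nat.cast_nonneg s
  nlinarith

theorem tendsto_log_log : Tendsto (fun n : ℕ => Real.log (Real.log n)) atTop atTop :=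
  Real.tendsto_log_atTop.comp (Real.tendsto_log_atTop.comp tendsto_natCast_atTop_atTop)

/-- The common bound on certificate size and message size. -/
theorem exists_le_of_mem_dAM : ∃ N : ℕ, ∀ (c : ℕ), 1 ≤ c → ∀ (R : Randomness) (σ γ : ℕ → ℕ∞)
    (L : DistributedLanguage c), (L = SymLang c ∨ L = (SymLang c)ᶜ) → L ∈ dAM R σ γ →
      ∀ n : ℕ, N ≤ n → ∀ s : ℕ, σ n = s ∨ γ n = s → 1 / 4 * Real.log (Real.log n) ≤ s := by
  obtain ⟨N, hN⟩ := eventually_atTop.1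
    (tendsto_log_log.eventually_ge_atTop (2 * Real.log 100))
  refine ⟨max N (100 ^ 4), fun c hc R σ γ L hL hmem n hn s hs => ?_⟩
  have hn' : 100 ^ 4 ≤ n := (le_max_right _ _).trans hn
  exact log_log_le (by omega) (hN n ((le_max_left _ _).trans hn))
    (lt_of_mem_dAM hc hL hmem hn' hs)

theorem ofReal_le_toENNReal {x : ℝ} {t : ℕ∞} (h : ∀ s : ℕ, t = s → x ≤ s) :
    ENNReal.ofReal x ≤ t.toENNReal := by
  induction t using ENat.recTopCoe with
  | top => simp
  | coe s =>
    rw [ENat.toENNReal_coe]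
    exact ENNReal.ofReal_le_of_le_toReal (by simpa using h s rfl)

end Bounds

theorem mainTheorem3 :
    (∃ C : ℝ, 0 < C ∧ ∃ N : ℕ, ∀ (c : ℕ), 1 ≤ c → ∀ (R : Randomness) (σ γ : ℕ → ℕ∞)
      (L : DistributedLanguage c), (L = SymLang c ∨ L = (SymLang c)ᶜ) → L ∈ dAM R σ γ →
        ∀ n : ℕ, N ≤ n →
          ENNReal.ofReal (C * Real.log (Real.log n)) ≤ (σ n).toENNReal ∧
          ENNReal.ofReal (C * Real.log (Real.log n)) ≤ (γ n).toENNReal) ∧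
    (∀ (c : ℕ), 1 ≤ c → ∀ (R : Randomness) (τ : ℕ → ℕ),
      (fun n => (τ n : ℝ)) =o[atTop] (fun n : ℕ => Real.log (Real.log n)) →
        ∀ L : DistributedLanguage c, (L = SymLang c ∨ L = (SymLang c)ᶜ) →
          L ∉ dAM R (fun n => (τ n : ℕ∞)) (fun _ => ⊤) ∧
          L ∉ dAM R (fun _ => ⊤) (fun n => (τ n : ℕ∞))) := by
  obtain ⟨N, hN⟩ := exists_le_of_mem_dAM
  refine ⟨⟨1 / 4, by norm_num, N, fun c hc R σ γ L hL hmem n hn => ?_⟩, ?_⟩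
  · have h := hN c hc R σ γ L hL hmem n hn
    exact ⟨ofReal_le_toENNReal fun s hs => h s (Or.inl hs),
      ofReal_le_toENNReal fun s hs => h s (Or.inr hs)⟩
  · intro c hc R τ hτ L hL
    have hsmall : ∃ n, N ≤ n ∧ (τ n : ℝ) < 1 / 4 * Real.log (Real.log n) := by
      have h1 := hτ.bound (show (0 : ℝ) < 1 / 8 by norm_num)
      have h2 := tendsto_log_log.eventually_gt_atTop 0
      obtain ⟨n, h1, h2, h3⟩ := (h1.and (h2.and (eventually_ge_atTop N))).exists
      refine ⟨n, h3, ?_⟩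
      rw [Real.norm_of_nonneg (Nat.cast_nonneg _), Real.norm_of_nonneg h2.le] at h1
      linarith
    obtain ⟨n, hn, hlt⟩ := hsmall
    exact ⟨fun h => hlt.not_ge (hN c hc R _ _ L hL h n hn (τ n) (Or.inl rfl)),
      fun h => hlt.not_ge (hN c hc R _ _ L hL h n hn (τ n) (Or.inr rfl))⟩
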